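/- **Theorem 5.2 (Evolution of the Ricci curvature).** Let $M$ be an $n$-dimensional smooth manifold and let $(g_{ij},A_i,B_{ij})$ be a smooth solution on $M\times[0,T)$ of the generalized Ricci flow $$\frac{\partial g_{ij}}{\partial t}=-2\Big[R_{ij}-\tfrac14H_{ikl}H_j{}^{kl}-F_i{}^{k}F_{jk}\Big],\qquad \frac{\partial A_i}{\partial t}=-\nabla_kF_i{}^{k},\qquad \frac{\partial B_{ij}}{\partial t}=\nabla_kH^{k}{}_{ij},$$ where $g$ is a Riemannian metric, $A$ a one-form, $B$ a two-form, $F=dA$, $H=dB$ (so $F_{ij}=\partial_iA_j-\partial_jA_i$ and $H_{ijk}=\partial_iB_{jk}+\partial_jB_{ki}+\partial_kB_{ij}$), $\nabla$ is the Levi-Civita connection of $g(t)$, and, with the Christoffel symbols $\Gamma^k_{ij}$ of $g(t)$, $$R^k_{ijl}=\partial_i\Gamma^k_{jl}-\partial_j\Gamma^k_{il}+\Gamma^k_{ip}\Gamma^p_{jl}-\Gamma^k_{jp}\Gamma^p_{il},\qquad R_{ijkl}=g_{kp}R^p_{ijl},\qquad R_{ik}=g^{jl}R_{ijkl}.$$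 Then, in any local coordinates on $M$ and for every $t\in[0,T)$ (with one-sided time derivatives at $t=0$), the Ricci curvature satisfies $$\begin{aligned}\frac{\partial}{\partial t}R_{ik}={}&\Delta R_{ik}+2g^{pr}g^{qs}R_{piqk}R_{rs}-2g^{pq}R_{pi}R_{qk}\\ &+\tfrac14g^{jl}\big[\nabla_i\nabla_l(H_{kpq}H_j{}^{pq})-\nabla_i\nabla_k(H_{jpq}H_l{}^{pq})-\nabla_j\nabla_l(H_{kpq}H_i{}^{pq})+\nabla_j\nabla_k(H_{ipq}H_l{}^{pq})\big]\\ &+\tfrac14g^{mn}\big(H_{kpq}H_m{}^{pq}R_{in}-g^{jl}H_{mpq}H_l{}^{pq}R_{ijkn}\big)\\ &+g^{jl}\big[\nabla_i\nabla_l(F_k{}^{p}F_{jp})-\nabla_i\nabla_k(F_j{}^{p}F_{lp})-\nabla_j\nabla_l(F_k{}^{p}F_{ip})+\nabla_j\nabla_k(F_i{}^{p}F_{lp})\big]\\ &+g^{mn}\big(F_k{}^{p}F_{mp}R_{in}-g^{jl}F_m{}^{p}F_{lp}R_{ijkn}\big),\end{aligned}$$ where $\Delta=g^{pq}\nabla_p\nabla_q$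 is the Laplacian with respect to the evolving metric and $\nabla_a\nabla_bS_{cd}$ denotes the component $(\nabla\nabla S)_{abcd}$ of the second covariant derivative. -/

import Mathlib

open scoped Manifold ContDiff Bundle Topology
open Set

noncomputable section

namespace GenRicciFlow

/-! ### Tensor calculus in local coordinates -/

/-- The components of a covariant tensor field of rank `r` in local coordinates
`y = (y¹, …, yⁿ)`: the component with lower indices `m 0, …, m (r-1)` at `y` is `S y m`. -/
abbrev CoordTensor (n r : ℕ) : Type :=
  EuclideanSpace ℝ (Fin n) → (Fin r → Fin n) → ℝ

/-- The `i`-th coordinate vector of `ℝⁿ`. -/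
abbrev coordVec {n : ℕ} (i : Fin n) : EuclideanSpace ℝ (Fin n) :=
  EuclideanSpace.single i 1

/-- The partial derivative `∂f/∂yⁱ`. -/
def pderiv {n : ℕ} (i : Fin n) (f : EuclideanSpace ℝ (Fin n) → ℝ)
    (y : EuclideanSpace ℝ (Fin n)) : ℝ :=
  fderiv ℝ f y (coordVec i)

/-- The inverse matrix `(g^{ij})` of the matrix `(g_{ij})`. -/
def ginv {n : ℕ} (g : CoordTensor n 2) (y : EuclideanSpace ℝ (Fin n)) :
    Matrix (Fin n) (Fin n) ℝ :=
  (Matrix.of fun i j => g y ![i, j])⁻¹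

/-- The Christoffel symbols
`Γ^k_{ij} = ½ g^{kl} (∂_i g_{jl} + ∂_j g_{il} - ∂_l g_{ij})`. -/
def christoffel {n : ℕ} (g : CoordTensor n 2) (k i j : Fin n)
    (y : EuclideanSpace ℝ (Fin n)) : ℝ :=
  (1 / 2) * ∑ l, ginv g y k l *
    (pderiv i (fun z => g z ![j, l]) y + pderiv j (fun z => g z ![i, l]) y
      - pderiv l (fun z => g z ![i, j]) y)

/-- The covariant derivative of a covariant tensor field of rank `r`; the new index, that of the
direction of differentiation, comes first: `covDeriv g S y ![i, j₁, …, j_r] = ∇_i S_{j₁ … j_r}`. -/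
def covDeriv {n r : ℕ} (g : CoordTensor n 2) (S : CoordTensor n r) : CoordTensor n (r + 1) :=
  fun y m =>
    pderiv (m 0) (fun z => S z (Fin.tail m)) y
      - ∑ s : Fin r, ∑ p, christoffel g p (m 0) (Fin.tail m s) y *
          S y (Function.update (Fin.tail m) s p)

/-- The curvature components
`R^k_{ijl} = ∂_i Γ^k_{jl} - ∂_j Γ^k_{il} + Γ^k_{ip} Γ^p_{jl} - Γ^k_{jp} Γ^p_{il}`. -/
def riemannUp {n : ℕ} (g : CoordTensor n 2) (k i j l : Fin n)
    (y : EuclideanSpace ℝ (Fin n)) : ℝ :=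
  pderiv i (christoffel g k j l) y - pderiv j (christoffel g k i l) y
    + ∑ p, christoffel g k i p y * christoffel g p j l y
    - ∑ p, christoffel g k j p y * christoffel g p i l y

/-- The Riemann tensor `R_{ijkl} = g_{kp} R^p_{ijl}`. -/
def riemann {n : ℕ} (g : CoordTensor n 2) : CoordTensor n 4 :=
  fun y m => ∑ p, g y ![m 2, p] * riemannUp g p (m 0) (m 1) (m 3) y

/-- The Ricci tensor `R_{ik} = g^{jl} R_{ijkl}`. -/
def ricci {n : ℕ} (g : CoordTensor n 2) : CoordTensor n 2 :=
  fun y m => ∑ j, ∑ l, ginv g y j l * riemann g y ![m 0, j, m 1, l]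

/-- The rough Laplacian of a tensor of rank two, `ΔS_{ik} = g^{pq} ∇_p ∇_q S_{ik}`. -/
def laplacian {n : ℕ} (g : CoordTensor n 2) (S : CoordTensor n 2) : CoordTensor n 2 :=
  fun y m => ∑ p, ∑ q, ginv g y p q * covDeriv g (covDeriv g S) y ![p, q, m 0, m 1]

/-- The tensor `H_{ipq} H_j^{pq} = g^{pr} g^{qs} H_{ipq} H_{jrs}`. -/
def contractHH {n : ℕ} (g : CoordTensor n 2) (H : CoordTensor n 3) : CoordTensor n 2 :=
  fun y m => ∑ p, ∑ q, ∑ r, ∑ s, ginv g y p r * ginv g y q s *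
    H y ![m 0, p, q] * H y ![m 1, r, s]

/-- The tensor `F_i^p F_{jp} = g^{pq} F_{iq} F_{jp}`. -/
def contractFF {n : ℕ} (g : CoordTensor n 2) (F : CoordTensor n 2) : CoordTensor n 2 :=
  fun y m => ∑ p, ∑ q, ginv g y p q * F y ![m 0, q] * F y ![m 1, p]

/-- The right-hand side of the evolution equation of the Ricci tensor, for a metric `g`, a two-form
`F` and a three-form `H` given by their components. With `T_{ij} = H_{ipq} H_j^{pq}` and
`U_{ij} = F_i^p F_{jp}` it is
`ΔR_{ik} + 2 g^{pr} g^{qs} R_{piqk} R_{rs} - 2 g^{pq} R_{pi} R_{qk}`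
`+ ¼ g^{jl} (∇_i∇_l T_{kj} - ∇_i∇_k T_{jl} - ∇_j∇_l T_{ki} + ∇_j∇_k T_{il})`
`+ ¼ g^{ab} (T_{ka} R_{ib} - g^{jl} T_{al} R_{ijkb})`
`+ g^{jl} (∇_i∇_l U_{kj} - ∇_i∇_k U_{jl} - ∇_j∇_l U_{ki} + ∇_j∇_k U_{il})`
`+ g^{ab} (U_{ka} R_{ib} - g^{jl} U_{al} R_{ijkb})`. -/
def ricciEvolutionRHS {n : ℕ} (g : CoordTensor n 2) (F : CoordTensor n 2) (H : CoordTensor n 3)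
    (y : EuclideanSpace ℝ (Fin n)) (i k : Fin n) : ℝ :=
  laplacian g (ricci g) y ![i, k]
    + 2 * ∑ p, ∑ q, ∑ r, ∑ s, ginv g y p r * ginv g y q s *
        riemann g y ![p, i, q, k] * ricci g y ![r, s]
    - 2 * ∑ p, ∑ q, ginv g y p q * ricci g y ![p, i] * ricci g y ![q, k]
    + 1 / 4 * ∑ j, ∑ l, ginv g y j l *
        (covDeriv g (covDeriv g (contractHH g H)) y ![i, l, k, j]
          - covDeriv g (covDeriv g (contractHH g H)) y ![i, k, j, l]
          - covDeriv g (covDeriv g (contractHH g H)) y ![j, l, k, i]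
          + covDeriv g (covDeriv g (contractHH g H)) y ![j, k, i, l])
    + 1 / 4 * ∑ a, ∑ b, ginv g y a b *
        (contractHH g H y ![k, a] * ricci g y ![i, b]
          - ∑ j, ∑ l, ginv g y j l * contractHH g H y ![a, l] * riemann g y ![i, j, k, b])
    + ∑ j, ∑ l, ginv g y j l *
        (covDeriv g (covDeriv g (contractFF g F)) y ![i, l, k, j]
          - covDeriv g (covDeriv g (contractFF g F)) y ![i, k, j, l]
          - covDeriv g (covDeriv g (contractFF g F)) y ![j, l, k, i]
          + covDeriv g (covDeriv g (contractFF g F)) y ![j, k, i, l])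
    + ∑ a, ∑ b, ginv g y a b *
        (contractFF g F y ![k, a] * ricci g y ![i, b]
          - ∑ j, ∑ l, ginv g y j l * contractFF g F y ![a, l] * riemann g y ![i, j, k, b])

/-! ### Fields on a manifold and their components in a chart -/

section Manifold

variable {n : ℕ} {M : Type*} [TopologicalSpace M] [ChartedSpace (EuclideanSpace ℝ (Fin n)) M]
  [IsManifold (𝓡 n) ∞ M]

variable (n M) in
/-- Smooth Riemannian metrics on the `n`-dimensional manifold `M`. -/
abbrev Metric : Type _ :=
  Bundle.ContMDiffRiemannianMetric (𝓡 n) ∞ (EuclideanSpace ℝ (Fin n))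
    (fun x : M => TangentSpace (𝓡 n) x)

variable (n M) in
/-- Differential forms of degree `r` on `M` (smoothness is required separately). -/
abbrev DiffForm (r : ℕ) : Type _ :=
  (x : M) → TangentSpace (𝓡 n) x [⋀^Fin r]→L[ℝ] ℝ

/-- The differential at `y` of the parametrization `φ⁻¹` of a chart `φ`; it sends the `i`-th
coordinate vector of `ℝⁿ` to the coordinate vector field `∂/∂yⁱ` at `φ⁻¹ y`. -/
def chartFrame (φ : OpenPartialHomeomorph M (EuclideanSpace ℝ (Fin n)))
    (y : EuclideanSpace ℝ (Fin n)) :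
    EuclideanSpace ℝ (Fin n) →L[ℝ] TangentSpace (𝓡 n) (φ.symm y) :=
  mfderiv (𝓡 n) (𝓡 n) φ.symm y

/-- The components `g_{ij}` of a metric in a chart. -/
def metricComp (g : Metric n M) (φ : OpenPartialHomeomorph M (EuclideanSpace ℝ (Fin n))) :
    CoordTensor n 2 :=
  fun y m => g.inner (φ.symm y) (chartFrame φ y (coordVec (m 0))) (chartFrame φ y (coordVec (m 1)))

/-- A differential form of degree `r` read in a chart, that is, its pullback under the
parametrization `φ⁻¹`. -/
def chartForm {r : ℕ} (η : DiffForm n M r)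
    (φ : OpenPartialHomeomorph M (EuclideanSpace ℝ (Fin n))) :
    EuclideanSpace ℝ (Fin n) → EuclideanSpace ℝ (Fin n) [⋀^Fin r]→L[ℝ] ℝ :=
  fun y => (η (φ.symm y)).compContinuousLinearMap (chartFrame φ y)

/-- The components of a differential form in a chart. -/
def formComp {r : ℕ} (η : DiffForm n M r)
    (φ : OpenPartialHomeomorph M (EuclideanSpace ℝ (Fin n))) : CoordTensor n r :=
  fun y m => chartForm η φ y (fun s => coordVec (m s))

/-- The components in a chart of the exterior derivative of a differential form. For a one-form
`A` they are `F_{ij} = ∂_i A_j - ∂_j A_i`, and for a two-form `B` they are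
`H_{ijk} = ∂_i B_{jk} + ∂_j B_{ki} + ∂_k B_{ij}`. -/
def dComp {r : ℕ} (η : DiffForm n M r)
    (φ : OpenPartialHomeomorph M (EuclideanSpace ℝ (Fin n))) : CoordTensor n (r + 1) :=
  fun y m => extDeriv (chartForm η φ) y (fun s => coordVec (m s))

/-- `(g, A, B)` is a smooth solution on `M × [0, T)` of the generalized Ricci flow
`∂_t g_{ij} = -2 (R_{ij} - ¼ H_{ikl} H_j^{kl} - F_i^k F_{jk})`,
`∂_t A_i = -∇_k F_i^k`, `∂_t B_{ij} = ∇_k H^k_{ij}`, where `F = dA` and `H = dB`.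
The equations are those of the components in all local coordinates, and the time derivative at
`t = 0` is one-sided. -/
structure IsSolution (T : ℝ) (g : ℝ → Metric n M) (A : ℝ → DiffForm n M 1)
    (B : ℝ → DiffForm n M 2) : Prop where
  smooth_metric : ∀ φ ∈ IsManifold.maximalAtlas (𝓡 n) ∞ M, ∀ i j : Fin n,
    ContDiffOn ℝ ∞ (fun p : ℝ × EuclideanSpace ℝ (Fin n) => metricComp (g p.1) φ p.2 ![i, j])
      (Ico 0 T ×ˢ φ.target)
  smooth_A : ∀ φ ∈ IsManifold.maximalAtlas (𝓡 n) ∞ M,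
    ContDiffOn ℝ ∞ (fun p : ℝ × EuclideanSpace ℝ (Fin n) => chartForm (A p.1) φ p.2)
      (Ico 0 T ×ˢ φ.target)
  smooth_B : ∀ φ ∈ IsManifold.maximalAtlas (𝓡 n) ∞ M,
    ContDiffOn ℝ ∞ (fun p : ℝ × EuclideanSpace ℝ (Fin n) => chartForm (B p.1) φ p.2)
      (Ico 0 T ×ˢ φ.target)
  metric_eq : ∀ φ ∈ IsManifold.maximalAtlas (𝓡 n) ∞ M, ∀ t ∈ Ico 0 T, ∀ y ∈ φ.target,
    ∀ i j : Fin n,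
      HasDerivWithinAt (fun s => metricComp (g s) φ y ![i, j])
        (-2 * (ricci (metricComp (g t) φ) y ![i, j]
          - 1 / 4 * contractHH (metricComp (g t) φ) (dComp (B t) φ) y ![i, j]
          - contractFF (metricComp (g t) φ) (dComp (A t) φ) y ![i, j]))
        (Ico 0 T) t
  A_eq : ∀ φ ∈ IsManifold.maximalAtlas (𝓡 n) ∞ M, ∀ t ∈ Ico 0 T, ∀ y ∈ φ.target,
    ∀ i : Fin n,
      HasDerivWithinAt (fun s => formComp (A s) φ y ![i])
        (-∑ k, ∑ l, ginv (metricComp (g t) φ) y k l *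
          covDeriv (metricComp (g t) φ) (dComp (A t) φ) y ![k, i, l])
        (Ico 0 T) t
  B_eq : ∀ φ ∈ IsManifold.maximalAtlas (𝓡 n) ∞ M, ∀ t ∈ Ico 0 T, ∀ y ∈ φ.target,
    ∀ i j : Fin n,
      HasDerivWithinAt (fun s => formComp (B s) φ y ![i, j])
        (∑ k, ∑ l, ginv (metricComp (g t) φ) y k l *
          covDeriv (metricComp (g t) φ) (dComp (B t) φ) y ![k, l, i, j])
        (Ico 0 T) t

end Manifold

end GenRicciFlow

end

noncomputable section

namespace GenRicciFlow

/-! ### Levi-Civita calculus over a differential ring -/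

/-! In a chart, the smooth functions on `[0, T) × U` form a commutative ring carrying commuting
derivations, the coordinate derivatives and the time derivative. Curvature is built from the metric
by ring operations, matrix inversion and derivations, so the theorem reduces to algebra with
Levi-Civita data over such a ring.

The algebra has two parts. First, the Palatini identity and the Koszul formula for the varied
connection express the variation of the Ricci tensor through second covariant derivatives of the
variation of `g`. Commuting one pair of derivatives gives `two_mul_var_Ric`: `2 τ Ric = linRic (τ
g)`, with `linRic` linear over ℝ. Along the flow `τ g = -2 Ric + ½ S + 2 U`, where `S` and `U` are
the contracted squares of `H` and `F`. Hence `τ Ric = -linRic Ric + ¼ linRic S + linRic U`, and the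
last two terms are already the `H` and `F` lines of the claim.

Second, `neg_linRic_Ric` identifies `-linRic Ric` with the classical Ricci flow reaction-diffusion
terms. The second derivatives other than the Laplacian cancel, up to curvature, by the contracted
second Bianchi identity.

The remaining work transfers this to the analytic statement. Evaluation at a space-time point is a
ring homomorphism, the derivations evaluate to actual derivatives (one-sided at `t = 0`), and
positive definiteness makes the determinant of the metric a unit. -/

theorem algebraMap_half_mul_two {R : Type*} [CommRing R] [Algebra ℝ R] :
    algebraMap ℝ R (1 / 2) * 2 = 1 := by
  rw [← map_ofNat (algebraMap ℝ R) 2, ← map_mul]; norm_num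

theorem eq_of_two_mul_eq {R : Type*} [CommRing R] [Algebra ℝ R] {x y : R} (h : 2 * x = 2 * y) :
    x = y := by
  linear_combination algebraMap ℝ R (1 / 2) * h - (x - y) * algebraMap_half_mul_two (R := R)

/-! ### Derivations acting entrywise on matrices -/

section DerivMatrix

variable {R : Type*} [CommRing R] [Algebra ℝ R] {n : ℕ}

/-- Entrywise application of a derivation to a matrix. -/
def derivMatrix (d : Derivation ℝ R R) (A : Matrix (Fin n) (Fin n) R) :
    Matrix (Fin n) (Fin n) R :=
  Matrix.of fun a b => d (A a b)

theorem derivMatrix_apply (d : Derivation ℝ R R) (A : Matrix (Fin n) (Fin n) R) (a b : Fin n) :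
    derivMatrix d A a b = d (A a b) := rfl

theorem derivMatrix_add (d : Derivation ℝ R R) (A B : Matrix (Fin n) (Fin n) R) :
    derivMatrix d (A + B) = derivMatrix d A + derivMatrix d B := by
  ext a b; simp [derivMatrix_apply]

theorem derivMatrix_sub (d : Derivation ℝ R R) (A B : Matrix (Fin n) (Fin n) R) :
    derivMatrix d (A - B) = derivMatrix d A - derivMatrix d B := by
  ext a b; simp [derivMatrix_apply]

theorem derivMatrix_transpose (d : Derivation ℝ R R) (A : Matrix (Fin n) (Fin n) R) :
    derivMatrix d A.transpose = (derivMatrix d A).transpose := rfl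

theorem derivMatrix_mul (d : Derivation ℝ R R) (A B : Matrix (Fin n) (Fin n) R) :
    derivMatrix d (A * B) = derivMatrix d A * B + A * derivMatrix d B := by
  ext a b
  simp only [derivMatrix_apply, Matrix.mul_apply, Matrix.add_apply, map_sum, Derivation.leibniz,
    smul_eq_mul, Finset.sum_add_distrib]
  rw [add_comm]
  congr 1
  exact Finset.sum_congr rfl fun _ _ => mul_comm _ _

theorem derivMatrix_one (d : Derivation ℝ R R) :
    derivMatrix d (1 : Matrix (Fin n) (Fin n) R) = 0 := by
  ext a b
  rw [derivMatrix_apply, Matrix.one_apply]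
  split_ifs <;> simp

theorem derivMatrix_comm {d e : Derivation ℝ R R} (h : ∀ f, d (e f) = e (d f))
    (A : Matrix (Fin n) (Fin n) R) :
    derivMatrix d (derivMatrix e A) = derivMatrix e (derivMatrix d A) := by
  ext a b; exact h _

theorem derivation_trace (d : Derivation ℝ R R) (A : Matrix (Fin n) (Fin n) R) :
    d A.trace = (derivMatrix d A).trace := by
  simp [Matrix.trace, derivMatrix_apply]

end DerivMatrix

/-- A symmetric invertible matrix over a ring with commuting derivations `∂ᵢ`, together with its
torsion-free metric connection `Γ i k j = Γ^k_{ij}`. -/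
structure LeviCivita (R : Type*) [CommRing R] [Algebra ℝ R] (n : ℕ) where
  /-- the coordinate derivations -/
  d : Fin n → Derivation ℝ R R
  d_comm : ∀ i j f, d i (d j f) = d j (d i f)
  /-- the metric -/
  G : Matrix (Fin n) (Fin n) R
  /-- the inverse metric -/
  Gi : Matrix (Fin n) (Fin n) R
  G_symm : G.transpose = G
  Gi_symm : Gi.transpose = Gi
  G_mul_Gi : G * Gi = 1
  /-- the connection coefficients -/
  Γ : Fin n → Matrix (Fin n) (Fin n) R
  Γ_symm : ∀ i j k, Γ i k j = Γ j k i
  compat : ∀ i, derivMatrix (d i) G = (Γ i).transpose * G + G * Γ i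

namespace LeviCivita

variable {R : Type*} [CommRing R] [Algebra ℝ R] {n : ℕ} (X : LeviCivita R n)

local notation "Mat" => Matrix (Fin n) (Fin n) R

theorem Gi_mul_G : X.Gi * X.G = 1 := mul_eq_one_comm.mp X.G_mul_Gi

theorem Gi_apply_comm (a b : Fin n) : X.Gi a b = X.Gi b a :=
  congrFun (congrFun X.Gi_symm b) a

/-- Differentiate `Gi * G = 1` and multiply on the right by `Gi`; this is the parallelism of the
inverse metric. -/
theorem derivMatrix_Gi (i : Fin n) :
    derivMatrix (X.d i) X.Gi = -(X.Γ i * X.Gi) - X.Gi * (X.Γ i).transpose := by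
  have h : derivMatrix (X.d i) (X.Gi * X.G) = 0 := by rw [X.Gi_mul_G, derivMatrix_one]
  rw [derivMatrix_mul, X.compat] at h
  have h2 := congrArg (· * X.Gi) h
  simp only [zero_mul] at h2
  have e : (derivMatrix (X.d i) X.Gi * X.G + X.Gi * ((X.Γ i).transpose * X.G + X.G * X.Γ i)) * X.Gi
      = derivMatrix (X.d i) X.Gi * (X.G * X.Gi) + X.Gi * (X.Γ i).transpose * (X.G * X.Gi)
        + (X.Gi * X.G) * X.Γ i * X.Gi := by noncomm_ring
  rw [e, X.G_mul_Gi, X.Gi_mul_G, mul_one, mul_one, one_mul] at h2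
  rw [← sub_eq_zero, ← h2]; abel

/-- The covariant derivative of a bilinear form in the direction `i`, the index `i` being
treated as a label. -/
def covM (i : Fin n) (S : Mat) : Mat :=
  derivMatrix (X.d i) S - (X.Γ i).transpose * S - S * X.Γ i

theorem covM_apply (i a b : Fin n) (S : Mat) :
    X.covM i S a b = X.d i (S a b) - ∑ p, X.Γ i p a * S p b - ∑ p, X.Γ i p b * S a p := by
  simp [covM, Matrix.mul_apply, derivMatrix_apply, mul_comm]

/-- The second covariant derivative `∇_i ∇_j S` of a bilinear form. -/
def hess (i j : Fin n) (S : Mat) : Mat :=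
  X.covM i (X.covM j S) - ∑ p, X.Γ i p j • X.covM p S

/-- The curvature endomorphisms: `Rup i j k l = R^k_{ijl}`. -/
def Rup (i j : Fin n) : Mat :=
  derivMatrix (X.d i) (X.Γ j) - derivMatrix (X.d j) (X.Γ i) + X.Γ i * X.Γ j - X.Γ j * X.Γ i

/-- The Riemann tensor `Rm i j k l = R_{ijkl}`. -/
def Rm (i j : Fin n) : Mat := X.G * X.Rup i j

/-- The contraction `g^{jl} S_{jl}`. -/
def contr (S : Mat) : R := ∑ j, ∑ l, X.Gi j l * S j l

/-- The Ricci tensor. -/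
def Ric : Mat := Matrix.of fun i k => X.contr (Matrix.of fun j l => X.Rm i j k l)

theorem contr_eq_trace (S : Mat) : X.contr S = (X.Gi * S).trace := by
  simp only [contr, Matrix.trace, Matrix.diag, Matrix.mul_apply]
  rw [Finset.sum_comm]
  simp only [X.Gi_apply_comm]

theorem contr_transpose (S : Mat) : X.contr S.transpose = X.contr S := by
  unfold contr
  rw [Finset.sum_comm]
  simp only [X.Gi_apply_comm, Matrix.transpose_apply]

theorem contr_add (S S' : Mat) : X.contr (S + S') = X.contr S + X.contr S' := by
  simp [contr, mul_add, Finset.sum_add_distrib]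

theorem contr_sub (S S' : Mat) : X.contr (S - S') = X.contr S - X.contr S' := by
  simp [contr, mul_sub, Finset.sum_sub_distrib]

theorem contr_smul (c : R) (S : Mat) : X.contr (c • S) = c * X.contr S := by
  simp [contr, Finset.mul_sum, mul_left_comm]

theorem contr_sum {ι : Type*} (s : Finset ι) (S : ι → Mat) :
    X.contr (∑ p ∈ s, S p) = ∑ p ∈ s, X.contr (S p) := by
  simp only [contr_eq_trace, Finset.mul_sum, Matrix.trace_sum]

/-- Contraction commutes with covariant differentiation because the inverse metric is parallel; the
one leftover connection term moves around the trace by cyclicity. -/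
theorem d_contr (i : Fin n) (S : Mat) : X.d i (X.contr S) = X.contr (X.covM i S) := by
  rw [contr_eq_trace, contr_eq_trace, derivation_trace, derivMatrix_mul, derivMatrix_Gi, covM]
  have e1 : (-(X.Γ i * X.Gi) - X.Gi * (X.Γ i).transpose) * S + X.Gi * derivMatrix (X.d i) S
      = X.Gi * derivMatrix (X.d i) S - X.Gi * (X.Γ i).transpose * S - X.Γ i * (X.Gi * S) := by
    noncomm_ring
  have e2 : X.Gi * (derivMatrix (X.d i) S - (X.Γ i).transpose * S - S * X.Γ i)
      = X.Gi * derivMatrix (X.d i) S - X.Gi * (X.Γ i).transpose * S - X.Gi * S * X.Γ i := by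
    noncomm_ring
  rw [e1, e2, Matrix.trace_sub, Matrix.trace_sub _ (X.Gi * S * X.Γ i), Matrix.trace_mul_comm]

theorem covM_add (i : Fin n) (S S' : Mat) :
    X.covM i (S + S') = X.covM i S + X.covM i S' := by
  simp only [covM, derivMatrix_add]; noncomm_ring

theorem covM_smul (i : Fin n) (c : ℝ) (S : Mat) : X.covM i (c • S) = c • X.covM i S := by
  ext a b
  simp [covM_apply, smul_sub, Finset.smul_sum]

theorem hess_add (i j : Fin n) (S S' : Mat) :
    X.hess i j (S + S') = X.hess i j S + X.hess i j S' := by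
  simp only [hess, covM_add, smul_add, Finset.sum_add_distrib]; abel

theorem hess_smul (i j : Fin n) (c : ℝ) (S : Mat) : X.hess i j (c • S) = c • X.hess i j S := by
  simp only [hess, covM_smul, smul_sub, Finset.smul_sum, smul_comm c]

theorem covM_transpose (i : Fin n) (S : Mat) :
    X.covM i S.transpose = (X.covM i S).transpose := by
  simp only [covM, derivMatrix_transpose, Matrix.transpose_sub, Matrix.transpose_mul,
    Matrix.transpose_transpose]
  abel

theorem hess_transpose (i j : Fin n) (S : Mat) :
    X.hess i j S.transpose = (X.hess i j S).transpose := by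
  simp only [hess, covM_transpose, Matrix.transpose_sub, Matrix.transpose_sum,
    Matrix.transpose_smul]

/-! #### Symmetries of the curvature -/

theorem Rup_swap (i j : Fin n) : X.Rup j i = -X.Rup i j := by
  unfold Rup; noncomm_ring

theorem Rm_swap (i j : Fin n) : X.Rm j i = -X.Rm i j := by
  rw [Rm, Rup_swap, Rm, mul_neg]

theorem Rup_eq_Gi_mul (i j : Fin n) : X.Rup i j = X.Gi * X.Rm i j := by
  rw [Rm, ← mul_assoc, Gi_mul_G, one_mul]

theorem commutator (i j : Fin n) (S : Mat) :
    X.covM i (X.covM j S) - X.covM j (X.covM i S)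
      = -((X.Rup i j).transpose * S) - S * X.Rup i j := by
  have h := derivMatrix_comm (X.d_comm i j) S
  simp only [covM, Rup, derivMatrix_sub, derivMatrix_mul, derivMatrix_transpose, h,
    Matrix.transpose_sub, Matrix.transpose_add, Matrix.transpose_mul]
  noncomm_ring

/-- The correction for the second derivative index is symmetric in `i`, `j` by torsion-freeness, so
it drops out of the commutator. -/
theorem hess_commutator (i j : Fin n) (S : Mat) :
    X.hess i j S - X.hess j i S = -((X.Rup i j).transpose * S) - S * X.Rup i j := by
  rw [← commutator]
  simp only [hess, X.Γ_symm i j]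
  abel

theorem covM_G (i : Fin n) : X.covM i X.G = 0 := by
  rw [covM, compat]; abel

/-- The Ricci identity applied to the metric, whose covariant derivative vanishes. -/
theorem Rm_transpose (i j : Fin n) : (X.Rm i j).transpose = -X.Rm i j := by
  have h := X.commutator i j X.G
  have h0 : ∀ i, X.covM i (0 : Mat) = 0 := fun i => by
    ext a b; simp [covM_apply]
  rw [covM_G, covM_G, h0, h0] at h
  rw [Rm, Matrix.transpose_mul, X.G_symm, ← sub_eq_zero, ← neg_eq_zero]
  rw [sub_zero] at h
  rw [h]
  abel

theorem Rm_antisymm (i j k l : Fin n) : X.Rm i j k l = -X.Rm i j l k :=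
  congrFun (congrFun (X.Rm_transpose i j) l) k

theorem Rup_bianchi (i j k l : Fin n) : X.Rup i j k l + X.Rup j l k i + X.Rup l i k j = 0 := by
  simp only [Rup, Matrix.sub_apply, Matrix.add_apply, derivMatrix_apply, Matrix.mul_apply]
  have e : ∀ p : Fin n, ∀ q, X.Γ p k q = X.Γ q k p := fun p q => X.Γ_symm _ _ _
  rw [e j l, e i l, e i j]
  simp only [X.Γ_symm j l, X.Γ_symm i l, X.Γ_symm i j]
  ring

theorem Rm_bianchi (i j k l : Fin n) : X.Rm i j k l + X.Rm j l k i + X.Rm l i k j = 0 := by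
  simp only [Rm, Matrix.mul_apply, ← Finset.sum_add_distrib, ← mul_add, Rup_bianchi, mul_zero,
    Finset.sum_const_zero]

/-- A signed sum of four first Bianchi identities, in which the antisymmetries of each index pair
leave only twice the claim. -/
theorem Rm_pair_symm (i j k l : Fin n) : X.Rm i j k l = X.Rm k l i j := by
  have a := X.Rm_antisymm
  have s : ∀ i j k l, X.Rm j i k l = -X.Rm i j k l := fun i j k l =>
    congrFun (congrFun (X.Rm_swap i j) k) l
  apply eq_of_two_mul_eq
  linear_combination X.Rm_bianchi i j k l - X.Rm_bianchi j k l i - X.Rm_bianchi k l i j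
    + X.Rm_bianchi l i j k - a j l k i - s i l k j + a i l k j + a j k l i + s i k l j - a i k l j
    + a i j l k + s j l i k - s i l j k - a k l j i

end LeviCivita

theorem sum_sum_comm {R : Type*} [AddCommMonoid R] {n : ℕ}
    (f : Fin n → Fin n → Fin n → Fin n → R) :
    ∑ j, ∑ l, ∑ a, ∑ b, f j l a b = ∑ a, ∑ b, ∑ j, ∑ l, f j l a b := by
  have h := Finset.sum_comm (s := Finset.univ) (t := Finset.univ)
    (f := fun x y : Fin n × Fin n => f x.1 x.2 y.1 y.2)
  simpa only [Fintype.sum_prod_type] using h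

namespace LeviCivita

variable {R : Type*} [CommRing R] [Algebra ℝ R] {n : ℕ} (X : LeviCivita R n)

local notation "Mat" => Matrix (Fin n) (Fin n) R

/-! #### Bianchi identities for the derivatives of the curvature -/

theorem covM_G_mul (i : Fin n) (A : Mat) :
    X.covM i (X.G * A) = X.G * (derivMatrix (X.d i) A + X.Γ i * A - A * X.Γ i) := by
  rw [covM, derivMatrix_mul, compat]; noncomm_ring

/-- The covariant derivative of the Riemann tensor: `covRm m i j k l = ∇_m R_{ijkl}`. -/
def covRm (m i j : Fin n) : Mat :=
  X.covM m (X.Rm i j) - ∑ p, X.Γ m p i • X.Rm p j - ∑ p, X.Γ m p j • X.Rm i p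

theorem covRm_swap (m i j : Fin n) : X.covRm m j i = -X.covRm m i j := by
  have h : X.covM m (X.Rm j i) = -X.covM m (X.Rm i j) := by
    rw [eq_neg_iff_add_eq_zero, ← covM_add, Rm_swap]
    ext; simp [covM_apply]
  rw [covRm, covRm, h]
  simp only [X.Rm_swap _ j, X.Rm_swap i, smul_neg, Finset.sum_neg_distrib]
  abel

theorem covRm_antisymm (m i j k l : Fin n) : X.covRm m i j l k = -X.covRm m i j k l := by
  have h : (X.covRm m i j).transpose = -X.covRm m i j := by
    have h : X.covM m (-X.Rm i j) = -X.covM m (X.Rm i j) := by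
      rw [eq_neg_iff_add_eq_zero, ← covM_add]
      ext; simp [covM_apply]
    simp only [covRm, Matrix.transpose_sub, Matrix.transpose_sum, Matrix.transpose_smul,
      ← covM_transpose, Rm_transpose, h, smul_neg, Finset.sum_neg_distrib]
    abel
  exact congrFun (congrFun h k) l

/-- The cyclic sum already vanishes when the form indices are mere labels, since the coordinate
derivations commute. The connection corrections for those indices then cancel in pairs by
torsion-freeness and antisymmetry. -/
theorem covRm_bianchi (m i j : Fin n) :
    X.covRm m i j + X.covRm i j m + X.covRm j m i = 0 := by
  have h : X.covM m (X.Rm i j) + X.covM i (X.Rm j m) + X.covM j (X.Rm m i) = 0 := by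
    simp only [Rm, covM_G_mul, Rup, derivMatrix_sub, derivMatrix_add, derivMatrix_mul,
      derivMatrix_comm (X.d_comm i m), derivMatrix_comm (X.d_comm j m),
      derivMatrix_comm (X.d_comm j i)]
    noncomm_ring
  have e1 : ∑ p, X.Γ j p i • X.Rm m p = -∑ p, X.Γ i p j • X.Rm p m := by
    simp only [X.Γ_symm i, X.Rm_swap _ m, smul_neg, Finset.sum_neg_distrib]
  have e2 : ∑ p, X.Γ i p m • X.Rm j p = -∑ p, X.Γ m p i • X.Rm p j := by
    simp only [X.Γ_symm i, X.Rm_swap _ j, smul_neg, Finset.sum_neg_distrib]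
  have e3 : ∑ p, X.Γ m p j • X.Rm i p = -∑ p, X.Γ j p m • X.Rm p i := by
    simp only [X.Γ_symm m, X.Rm_swap _ i, smul_neg, Finset.sum_neg_distrib]
  simp only [covRm, e1, e2, e3]
  rw [← h]
  abel

theorem Ric_symm (i k : Fin n) : X.Ric i k = X.Ric k i := by
  simp only [Ric, Matrix.of_apply]
  rw [← contr_transpose]
  congr 1
  ext j l
  simp only [Matrix.transpose_apply, Matrix.of_apply]
  rw [X.Rm_pair_symm i l k j]

theorem Ric_transpose : X.Ric.transpose = X.Ric := by
  ext i k; exact X.Ric_symm k i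

/-- Contraction over `j`, `l` against the parallel inverse metric. In `covRm` the matrix indices are
`k`, `l`, so the four connection terms are regrouped to let `covM` act on `j`, `l` instead. -/
theorem covM_Ric (m i k : Fin n) :
    X.covM m X.Ric i k = X.contr (Matrix.of fun j l => X.covRm m i j k l) := by
  have e : (Matrix.of fun j l => X.covRm m i j k l)
      = X.covM m (Matrix.of fun j l => X.Rm i j k l)
        - (∑ p, X.Γ m p i • Matrix.of fun j l => X.Rm p j k l)
        - ∑ p, X.Γ m p k • Matrix.of fun j l => X.Rm i j p l := by
    ext j l
    simp only [covRm, Matrix.of_apply, Matrix.sub_apply, covM_apply, Matrix.sum_apply,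
      Matrix.smul_apply, smul_eq_mul]
    ring
  rw [e, contr_sub, contr_sub, contr_sum, contr_sum, ← d_contr, covM_apply]
  simp only [contr_smul, Ric, Matrix.of_apply]

/-- The twice contracted second Bianchi identity: one of the three traces is the differential of the
scalar curvature, the other two are each minus the divergence of Ricci. -/
theorem contr_covM_Ric (m : Fin n) :
    X.contr (X.covM m X.Ric) = 2 * X.contr (Matrix.of fun i k => X.covM i X.Ric m k) := by
  have h1 : X.contr (Matrix.of fun i k => X.contr (Matrix.of fun j l => X.covRm m i j k l))
      = X.contr (X.covM m X.Ric) := by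
    simp only [← covM_Ric]; rfl
  have h2 : X.contr (Matrix.of fun i k => X.contr (Matrix.of fun j l => X.covRm i j m k l))
      = -X.contr (Matrix.of fun i k => X.covM i X.Ric m k) := by
    have e : ∀ i k, (Matrix.of fun j l => X.covRm i j m k l)
        = (-1 : R) • Matrix.of fun j l => X.covRm i m j k l := fun i k => by
      ext j l; simp [X.covRm_swap i m j]
    simp only [e, contr_smul, ← covM_Ric]
    refine Eq.trans ?_ (neg_eq_neg_one_mul _).symm
    rw [← contr_smul]
    rfl
  have h3 : X.contr (Matrix.of fun i k => X.contr (Matrix.of fun j l => X.covRm j m i k l))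
      = -X.contr (Matrix.of fun j l => X.covM j X.Ric m l) := by
    -- Exchanging the two contractions makes `i`, `k` the inner pair, which the antisymmetry in the
    -- last two indices turns into a Ricci trace.
    have e : X.contr (Matrix.of fun i k => X.contr (Matrix.of fun j l => X.covRm j m i k l))
        = X.contr (Matrix.of fun j l => X.contr (Matrix.of fun i k => X.covRm j m i k l)) := by
      simp only [contr, Matrix.of_apply, Finset.mul_sum]
      rw [Finset.sum_congr rfl fun i _ => Finset.sum_comm, Finset.sum_comm]
      refine Finset.sum_congr rfl fun j _ => ?_
      rw [Finset.sum_congr rfl fun i _ => Finset.sum_comm, Finset.sum_comm]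
      simp only [mul_left_comm]
    have e' : ∀ j l, (Matrix.of fun i k => X.covRm j m i k l)
        = (-1 : R) • Matrix.of fun i k => X.covRm j m i l k := fun j l => by
      ext i k; simp [X.covRm_antisymm j m i k l]
    rw [e]
    simp only [e', contr_smul, ← covM_Ric]
    refine Eq.trans ?_ (neg_eq_neg_one_mul _).symm
    rw [← contr_smul]
    rfl
  have h : X.contr (Matrix.of fun i k => X.contr (Matrix.of fun j l => X.covRm m i j k l))
      + X.contr (Matrix.of fun i k => X.contr (Matrix.of fun j l => X.covRm i j m k l))
      + X.contr (Matrix.of fun i k => X.contr (Matrix.of fun j l => X.covRm j m i k l)) = 0 := by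
    rw [← contr_add, ← contr_add]
    have e : (Matrix.of fun i k => X.contr (Matrix.of fun j l => X.covRm m i j k l))
      + (Matrix.of fun i k => X.contr (Matrix.of fun j l => X.covRm i j m k l))
      + (Matrix.of fun i k => X.contr (Matrix.of fun j l => X.covRm j m i k l)) = (0 : Mat) := by
      ext i k
      simp only [Matrix.add_apply, Matrix.of_apply, ← contr_add]
      have e : (Matrix.of fun j l => X.covRm m i j k l) + (Matrix.of fun j l => X.covRm i j m k l)
        + (Matrix.of fun j l => X.covRm j m i k l) = (0 : Mat) := by
        ext j l
        exact congrFun (congrFun (X.covRm_bianchi m i j) k) l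
      rw [e]; simp [contr]
    rw [e]; simp [contr]
  rw [h1, h2, h3] at h
  linear_combination h

/-! #### Contracted second derivatives -/

theorem contr_hess (i k : Fin n) (S : Mat) :
    X.contr (X.hess i k S) = X.d i (X.d k (X.contr S)) - ∑ p, X.Γ i p k * X.d p (X.contr S) := by
  simp only [hess, contr_sub, contr_sum, contr_smul, d_contr]

theorem contr_hess_comm (i k : Fin n) (S : Mat) :
    X.contr (X.hess i k S) = X.contr (X.hess k i S) := by
  simp only [contr_hess, X.d_comm i k, X.Γ_symm i k]

theorem contr_hess_right (i k : Fin n) (S : Mat) :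
    X.contr (Matrix.of fun l j => X.hess i l S k j)
      = X.d i (X.contr (Matrix.of fun l j => X.covM l S k j))
        - ∑ p, X.Γ i p k * X.contr (Matrix.of fun l j => X.covM l S p j) := by
  have e : (Matrix.of fun l j => X.hess i l S k j)
      = X.covM i (Matrix.of fun l j => X.covM l S k j)
        - ∑ p, X.Γ i p k • Matrix.of fun l j => X.covM l S p j := by
    ext l j
    simp only [hess, Matrix.of_apply, Matrix.sub_apply, X.covM_apply i, Matrix.sum_apply,
      Matrix.smul_apply, smul_eq_mul]
    ring
  rw [e, contr_sub, contr_sum, ← d_contr]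
  simp only [contr_smul]

/-- The covariant derivative of the contracted Bianchi identity. -/
theorem two_mul_contr_hess_Ric (i k : Fin n) :
    2 * X.contr (Matrix.of fun l j => X.hess i l X.Ric k j) = X.contr (X.hess i k X.Ric) := by
  rw [contr_hess_right, contr_hess]
  simp only [d_contr _ _ X.Ric, contr_covM_Ric, mul_left_comm _ (2 : R), ← Finset.mul_sum]
  rw [two_mul (X.contr _), map_add]
  ring

/-- The traced Ricci identity. It is the source of the zeroth-order curvature terms in the evolution
equation. -/
theorem contr_commutator (i k : Fin n) (S : Mat) :
    X.contr (Matrix.of fun j l => X.hess j i S k l)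
      = X.contr (Matrix.of fun j l => X.hess i l S k j)
        + X.contr (Matrix.of fun a b => S k a * X.Ric i b
            - X.contr (Matrix.of fun j l => S a l * X.Rm i j k b)) := by
  have e : ∀ j l, X.hess j i S k l - X.hess i j S k l
      = ∑ a, ∑ b, X.Gi a b * (S k a * X.Rm i j b l - S a l * X.Rm i j k b) := by
    intro j l
    have h := congrFun (congrFun (X.hess_commutator j i S) k) l
    rw [Matrix.sub_apply] at h
    rw [h, Rup_swap, Rup_eq_Gi_mul]
    simp only [Matrix.sub_apply, Matrix.neg_apply, Matrix.mul_apply, Matrix.transpose_apply,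
      Finset.sum_mul, Finset.mul_sum, ← Finset.sum_neg_distrib, ← Finset.sum_sub_distrib]
    refine Finset.sum_congr rfl fun a _ => Finset.sum_congr rfl fun b _ => ?_
    rw [X.Rm_antisymm i j k b]
    ring
  have h : X.contr (Matrix.of fun j l => X.hess i l S k j)
      = X.contr (Matrix.of fun j l => X.hess i j S k l) :=
    X.contr_transpose (Matrix.of fun j l => X.hess i j S k l)
  rw [← sub_eq_iff_eq_add', h, ← contr_sub]
  simp only [contr, Ric, Matrix.of_apply, Matrix.sub_apply, e, Finset.mul_sum,
    ← Finset.sum_sub_distrib]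
  rw [sum_sum_comm]
  refine Finset.sum_congr rfl fun a _ => Finset.sum_congr rfl fun b _ => ?_
  refine Finset.sum_congr rfl fun j _ => Finset.sum_congr rfl fun l _ => ?_
  ring

/-! #### Variation of the Ricci tensor -/

/-- Ricci as a trace of the curvature endomorphism does not involve the metric explicitly, so its
variation needs only the variation of the connection. -/
theorem Ric_eq_sum_Rup (i k : Fin n) : X.Ric i k = ∑ j, X.Rup j i j k := by
  simp only [Ric, Matrix.of_apply, Rup_eq_Gi_mul, Matrix.mul_apply, contr]
  refine Finset.sum_congr rfl fun j _ => Finset.sum_congr rfl fun l _ => ?_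
  rw [X.Rm_antisymm, X.Rm_swap j i]
  simp

variable (τ : Derivation ℝ R R)

/-- The covariant derivative of the variation `τΓ` of the connection. -/
def covVar (i j : Fin n) : Mat :=
  derivMatrix (X.d i) (derivMatrix τ (X.Γ j)) + X.Γ i * derivMatrix τ (X.Γ j)
    - derivMatrix τ (X.Γ j) * X.Γ i - ∑ p, X.Γ i p j • derivMatrix τ (X.Γ p)

theorem covVar_symm (i j a k : Fin n) : X.covVar τ i j a k = X.covVar τ i k a j := by
  have e : ∀ j k, ∑ p, τ (X.Γ j a p) * X.Γ i p k = ∑ p, X.Γ i p k * τ (X.Γ p a j) := fun j k =>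
    Finset.sum_congr rfl fun p _ => by rw [X.Γ_symm j p, mul_comm]
  simp only [covVar, Matrix.sub_apply, Matrix.add_apply, Matrix.mul_apply, Matrix.sum_apply,
    Matrix.smul_apply, smul_eq_mul, derivMatrix_apply, X.Γ_symm j k, e]
  ring

variable {τ} (hτ : ∀ i f, τ (X.d i f) = X.d i (τ f))

include hτ

/-- Palatini identity; the corrections for the form index cancel because the connection is
symmetric. -/
theorem var_Rup (i j : Fin n) :
    derivMatrix τ (X.Rup i j) = X.covVar τ i j - X.covVar τ j i := by
  simp only [Rup, covVar, derivMatrix_add, derivMatrix_sub, derivMatrix_mul, X.Γ_symm i j,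
    derivMatrix_comm (hτ i), derivMatrix_comm (hτ j)]
  noncomm_ring

theorem var_Ric (i k : Fin n) :
    τ (X.Ric i k) = ∑ j, X.covVar τ j i j k - ∑ j, X.covVar τ i k j j := by
  rw [Ric_eq_sum_Rup, map_sum, ← Finset.sum_sub_distrib]
  refine Finset.sum_congr rfl fun j _ => ?_
  rw [← derivMatrix_apply, X.var_Rup hτ, Matrix.sub_apply, X.covVar_symm τ i j]

theorem covM_var (i : Fin n) :
    X.covM i (derivMatrix τ X.G)
      = (X.G * derivMatrix τ (X.Γ i)).transpose + X.G * derivMatrix τ (X.Γ i) := by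
  have h := congrArg (derivMatrix τ) (X.compat i)
  rw [derivMatrix_comm (hτ i), derivMatrix_add, derivMatrix_mul, derivMatrix_mul] at h
  rw [covM, h, Matrix.transpose_mul, X.G_symm, derivMatrix_transpose]
  abel

/-- The Koszul argument for the varied connection: `covM_var` gives the sum of two lowered
components of `τΓ`, and symmetry in the lower indices lets an alternating sum isolate one. -/
theorem two_mul_G_mul_var (i j k : Fin n) :
    2 * (X.G * derivMatrix τ (X.Γ i)) k j
      = X.covM i (derivMatrix τ X.G) j k + X.covM j (derivMatrix τ X.G) i k
        - X.covM k (derivMatrix τ X.G) i j := by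
  have s : ∀ i j k, (X.G * derivMatrix τ (X.Γ i)) k j = (X.G * derivMatrix τ (X.Γ j)) k i := by
    intro i j k
    simp only [Matrix.mul_apply, derivMatrix_apply, X.Γ_symm i j]
  simp only [X.covM_var hτ, Matrix.add_apply, Matrix.transpose_apply]
  rw [s j i k, s k i j, s k j i]
  ring

theorem covVar_eq (i j a k : Fin n) :
    2 * (X.G * X.covVar τ i j) a k = X.hess i j (derivMatrix τ X.G) k a
      + X.hess i k (derivMatrix τ X.G) j a - X.hess i a (derivMatrix τ X.G) j k := by
  have e : X.G * X.covVar τ i j = X.covM i (X.G * derivMatrix τ (X.Γ j))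
      - ∑ p, X.Γ i p j • (X.G * derivMatrix τ (X.Γ p)) := by
    rw [covM_G_mul, covVar, mul_sub, Finset.mul_sum]
    simp only [mul_smul_comm]
  rw [e]
  have d2 : ∀ f, 2 * X.d i f = X.d i (2 * f) := fun f => by
    rw [two_mul, two_mul, map_add]
  simp only [Matrix.sub_apply, Matrix.sum_apply, Matrix.smul_apply, smul_eq_mul, X.covM_apply i,
    mul_sub, d2, Finset.mul_sum, mul_left_comm (2 : R), X.two_mul_G_mul_var hτ, hess, mul_add,
    map_add, map_sub, Finset.sum_add_distrib, Finset.sum_sub_distrib]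
  ring

/-- The two traces in `var_Ric` yield six second-derivative terms; two cancel by symmetry of the
inverse metric. -/
theorem two_mul_var_Ric_aux (i k : Fin n) :
    2 * τ (X.Ric i k) = X.contr (Matrix.of fun j l => X.hess j i (derivMatrix τ X.G) k l)
      + X.contr (Matrix.of fun j l => X.hess j k (derivMatrix τ X.G) i l)
      - X.contr (Matrix.of fun j l => X.hess j l (derivMatrix τ X.G) i k)
      - X.contr (X.hess i k (derivMatrix τ X.G)) := by
  have e : ∀ i j a k, 2 * X.covVar τ i j a k
      = ∑ l, X.Gi a l * (X.hess i j (derivMatrix τ X.G) k l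
        + X.hess i k (derivMatrix τ X.G) j l - X.hess i l (derivMatrix τ X.G) j k) := by
    intro i j a k
    have h : X.covVar τ i j = X.Gi * (X.G * X.covVar τ i j) := by
      rw [← mul_assoc, Gi_mul_G, one_mul]
    conv_lhs => rw [h, Matrix.mul_apply]
    simp only [Finset.mul_sum, mul_left_comm (2 : R), X.covVar_eq hτ]
  have h : X.contr (Matrix.of fun j l => X.hess i l (derivMatrix τ X.G) k j)
      = X.contr (Matrix.of fun j l => X.hess i j (derivMatrix τ X.G) k l) :=
    X.contr_transpose (Matrix.of fun j l => X.hess i j (derivMatrix τ X.G) k l)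
  rw [X.var_Ric hτ, mul_sub, Finset.mul_sum, Finset.mul_sum]
  simp only [e]
  simp only [contr, Matrix.of_apply, mul_add, mul_sub, Finset.sum_add_distrib,
    Finset.sum_sub_distrib] at h ⊢
  rw [h]
  ring

end LeviCivita

/-! ### The linearized Ricci operator and the flow -/

section

variable {R : Type*} [CommRing R] [Algebra ℝ R] {n : ℕ} (X : LeviCivita R n)

namespace LeviCivita

local notation "Mat" => Matrix (Fin n) (Fin n) R

/-- Twice the linearization of the Ricci tensor, in the direction of a symmetric form `S`. -/
def linRic (S : Mat) (i k : Fin n) : R :=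
  X.contr (Matrix.of fun j l => X.hess i l S k j - X.hess i k S j l - X.hess j l S k i
      + X.hess j k S i l)
    + X.contr (Matrix.of fun a b => S k a * X.Ric i b
        - X.contr (Matrix.of fun j l => S a l * X.Rm i j k b))

theorem linRic_add (S S' : Mat) (i k : Fin n) :
    X.linRic (S + S') i k = X.linRic S i k + X.linRic S' i k := by
  simp only [linRic, contr, Matrix.of_apply, hess_add, Matrix.add_apply, mul_add, mul_sub, add_mul,
    Finset.sum_add_distrib, Finset.sum_sub_distrib]
  ring

theorem linRic_smul (c : ℝ) (S : Mat) (i k : Fin n) :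
    X.linRic (c • S) i k = c • X.linRic S i k := by
  simp only [linRic, contr, Matrix.of_apply, hess_smul, Matrix.smul_apply, smul_mul_assoc,
    ← smul_sub, ← smul_add, mul_smul_comm, ← Finset.smul_sum]

/-- In `two_mul_var_Ric_aux`, commuting `∇_j ∇_i` into `∇_i ∇_j` in one divergence term produces
exactly the curvature terms of `linRic`. -/
theorem two_mul_var_Ric {τ : Derivation ℝ R R} (hτ : ∀ i f, τ (X.d i f) = X.d i (τ f))
    (i k : Fin n) : 2 * τ (X.Ric i k) = X.linRic (derivMatrix τ X.G) i k := by
  have t : (derivMatrix τ X.G).transpose = derivMatrix τ X.G := by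
    rw [← derivMatrix_transpose, G_symm]
  have hs : ∀ i j a b, X.hess i j (derivMatrix τ X.G) a b = X.hess i j (derivMatrix τ X.G) b a := by
    intro i j a b
    conv_lhs => rw [← t, hess_transpose]
    rfl
  rw [X.two_mul_var_Ric_aux hτ, contr_commutator, linRic]
  simp only [contr, Matrix.of_apply, mul_add, mul_sub, Finset.sum_add_distrib,
    Finset.sum_sub_distrib, fun j l => hs j l k i]
  ring

/-- By the contracted Bianchi identity each divergence term is half the Hessian of the scalar
curvature, so together they cancel the trace term. One of them must first be commuted, which doubles
the quadratic curvature expression already present in `linRic`. -/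
theorem neg_linRic_Ric (i k : Fin n) :
    -X.linRic X.Ric i k = X.contr (Matrix.of fun p q => X.hess p q X.Ric i k)
      + 2 * ∑ p, ∑ q, ∑ r, ∑ s, X.Gi p r * X.Gi q s * X.Rm p i q k * X.Ric r s
      - 2 * ∑ p, ∑ q, X.Gi p q * X.Ric p i * X.Ric q k := by
  have hs : ∀ i j a b, X.hess i j X.Ric a b = X.hess i j X.Ric b a := by
    intro i j a b
    conv_lhs => rw [← Ric_transpose, hess_transpose]
    rfl
  have e1 := X.contr_commutator k i X.Ric
  have e2 := X.two_mul_contr_hess_Ric i k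
  have e3 := X.two_mul_contr_hess_Ric k i
  have e4 := X.contr_hess_comm i k X.Ric
  have q : ∀ i k, X.contr (Matrix.of fun a b => X.Ric k a * X.Ric i b
        - X.contr (Matrix.of fun j l => X.Ric a l * X.Rm i j k b))
      = ∑ p, ∑ q, X.Gi p q * X.Ric p i * X.Ric q k
        - ∑ p, ∑ q, ∑ r, ∑ s, X.Gi p r * X.Gi q s * X.Rm p i q k * X.Ric r s := by
    intro i k
    have hr : ∀ i j k l, X.Rm i j k l = X.Rm j i l k := fun i j k l => by
      rw [X.Rm_antisymm, X.Rm_swap j i]; simp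
    have h1 : ∑ p, ∑ q, X.Gi p q * X.Ric p i * X.Ric q k
        = ∑ a, ∑ b, X.Gi a b * (X.Ric k a * X.Ric i b) := by
      rw [Finset.sum_comm]
      refine Finset.sum_congr rfl fun a _ => Finset.sum_congr rfl fun b _ => ?_
      rw [X.Gi_apply_comm, X.Ric_symm k, X.Ric_symm i]; ring
    have h2 : ∑ p, ∑ q, ∑ r, ∑ s, X.Gi p r * X.Gi q s * X.Rm p i q k * X.Ric r s
        = ∑ a, ∑ b, ∑ j, ∑ l, X.Gi a b * (X.Gi j l * (X.Ric a l * X.Rm i j k b)) := by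
      rw [sum_sum_comm (fun a b j l => X.Gi a b * (X.Gi j l * (X.Ric a l * X.Rm i j k b)))]
      refine Finset.sum_congr rfl fun p _ => ?_
      rw [Finset.sum_comm]
      refine Finset.sum_congr rfl fun r _ => ?_
      rw [Finset.sum_comm]
      refine Finset.sum_congr rfl fun s _ => Finset.sum_congr rfl fun q _ => ?_
      rw [hr i, X.Ric_symm s, X.Gi_apply_comm s]; ring
    rw [h1, h2]
    simp only [contr, Matrix.of_apply, mul_sub, Finset.sum_sub_distrib, Finset.mul_sum]
  -- The commutator was used with `i` and `k` exchanged, so both quadratic terms must be symmetric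
  -- in them.
  have q' : ∑ p, ∑ q, ∑ r, ∑ s, X.Gi p r * X.Gi q s * X.Rm p k q i * X.Ric r s
      = ∑ p, ∑ q, ∑ r, ∑ s, X.Gi p r * X.Gi q s * X.Rm p i q k * X.Ric r s := by
    rw [Finset.sum_comm]
    refine Finset.sum_congr rfl fun a _ => Finset.sum_congr rfl fun b _ => ?_
    rw [Finset.sum_comm]
    refine Finset.sum_congr rfl fun c _ => Finset.sum_congr rfl fun d _ => ?_
    rw [X.Rm_pair_symm, X.Ric_symm]; ring
  have q'' : ∑ p, ∑ q, X.Gi p q * X.Ric p k * X.Ric q i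
      = ∑ p, ∑ q, X.Gi p q * X.Ric p i * X.Ric q k := by
    rw [Finset.sum_comm]
    refine Finset.sum_congr rfl fun a _ => Finset.sum_congr rfl fun b _ => ?_
    rw [X.Gi_apply_comm]; ring
  apply eq_of_two_mul_eq
  rw [q, q', q''] at e1
  rw [linRic, q]
  have e : X.contr (Matrix.of fun j l => X.hess i l X.Ric k j - X.hess i k X.Ric j l
        - X.hess j l X.Ric k i + X.hess j k X.Ric i l)
      = X.contr (Matrix.of fun j l => X.hess i j X.Ric k l) - X.contr (X.hess i k X.Ric)
        - X.contr (Matrix.of fun p q => X.hess p q X.Ric i k)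
        + X.contr (Matrix.of fun j l => X.hess j k X.Ric i l) := by
    have h : X.contr (Matrix.of fun j l => X.hess i l X.Ric k j)
      = X.contr (Matrix.of fun j l => X.hess i j X.Ric k l) :=
      X.contr_transpose (Matrix.of fun j l => X.hess i j X.Ric k l)
    rw [← h, ← contr_sub, ← contr_sub, ← contr_add]
    congr 1
    ext j l
    simp only [Matrix.add_apply, Matrix.sub_apply, Matrix.of_apply, hs j l k i]
  have h : X.contr (Matrix.of fun j l => X.hess k l X.Ric i j)
      = X.contr (Matrix.of fun j l => X.hess k j X.Ric i l) :=
      X.contr_transpose (Matrix.of fun j l => X.hess k j X.Ric i l)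
  rw [e]
  rw [h] at e1
  linear_combination -e2 - e3 + e4 - 2 * e1

/-- The evolution of the Ricci tensor when `τ g = -2 (Ric - ¼ S - U)`. -/
theorem var_Ric_flow {τ : Derivation ℝ R R} (hτ : ∀ i f, τ (X.d i f) = X.d i (τ f)) (S U : Mat)
    (h : derivMatrix τ X.G = (-2 : ℝ) • X.Ric + (1 / 2 : ℝ) • S + (2 : ℝ) • U) (i k : Fin n) :
    τ (X.Ric i k) = -X.linRic X.Ric i k + (1 / 4 : ℝ) • X.linRic S i k + X.linRic U i k := by
  have e := X.two_mul_var_Ric hτ i k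
  rw [h, linRic_add, linRic_add, linRic_smul, linRic_smul, linRic_smul] at e
  have e' : τ (X.Ric i k) = (1 / 2 : ℝ) • (2 * τ (X.Ric i k)) := by
    rw [two_mul, ← two_smul ℝ, smul_smul]; norm_num
  rw [e', e]
  module

end LeviCivita

end

/-! ### The Levi-Civita connection of an invertible symmetric matrix -/

section

variable {R : Type*} [CommRing R] [Algebra ℝ R] {n : ℕ}

/-- The Levi-Civita connection of a symmetric invertible matrix. -/
def LeviCivita.ofMetric (d : Fin n → Derivation ℝ R R)
    (d_comm : ∀ i j f, d i (d j f) = d j (d i f)) (G : Matrix (Fin n) (Fin n) R)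
    (G_symm : G.transpose = G) (hG : IsUnit G.det) : LeviCivita R n where
  d := d
  d_comm := d_comm
  G := G
  Gi := G⁻¹
  G_symm := G_symm
  Gi_symm := by rw [Matrix.transpose_nonsing_inv, G_symm]
  G_mul_Gi := Matrix.mul_nonsing_inv G hG
  Γ := fun i => Matrix.of fun k j => algebraMap ℝ R (1 / 2) *
    ∑ l, G⁻¹ k l * (d i (G j l) + d j (G i l) - d l (G i j))
  Γ_symm := fun i j k => by
    have h : G i j = G j i := congrFun (congrFun G_symm j) i
    simp only [Matrix.of_apply, h, add_comm (d i _)]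
  compat := fun i => by
    have h : ∀ a b, G a b = G b a := fun a b => congrFun (congrFun G_symm b) a
    have key : ∀ k j, (G * Matrix.of fun k j => algebraMap ℝ R (1 / 2) *
        ∑ l, G⁻¹ k l * (d i (G j l) + d j (G i l) - d l (G i j))) k j
        = algebraMap ℝ R (1 / 2) * (d i (G j k) + d j (G i k) - d k (G i j)) := by
      intro k j
      -- Lowering the upper Christoffel index cancels the inverse metric.
      have e : ∀ v : Fin n → R, ∑ p, G k p * ∑ l, G⁻¹ p l * v l = v k := fun v => by
        have := congrFun (Matrix.mulVec_mulVec v G G⁻¹) k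
        rw [Matrix.mul_nonsing_inv G hG, Matrix.one_mulVec] at this
        exact this
      rw [Matrix.mul_apply, ← e fun l => d i (G j l) + d j (G i l) - d l (G i j), Finset.mul_sum]
      simp only [Matrix.of_apply, mul_left_comm]
    have tr : ∀ A : Matrix (Fin n) (Fin n) R, A.transpose * G = (G * A).transpose := fun A => by
      rw [Matrix.transpose_mul, G_symm]
    rw [tr]
    ext a b
    rw [Matrix.add_apply, Matrix.transpose_apply, key, key, derivMatrix_apply, h b a]
    linear_combination -(d i (G a b)) * (algebraMap_half_mul_two (R := R))

end

/-! ### Smooth functions on a set, as a differential ring -/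

section SmoothRing

variable {V : Type*} [NormedAddCommGroup V] [NormedSpace ℝ V]

/-- The algebra of the restrictions to `Ω` of functions that are smooth on `Ω`. -/
def smoothRing (Ω : Set V) : Subalgebra ℝ (Ω → ℝ) where
  carrier := {f | ∃ F : V → ℝ, ContDiffOn ℝ ∞ F Ω ∧ ∀ p : Ω, F p = f p}
  mul_mem' := by
    rintro f g ⟨F, hF, hf⟩ ⟨G, hG, hg⟩
    exact ⟨fun p => F p * G p, hF.mul hG, fun p => by simp [hf, hg]⟩
  add_mem' := by
    rintro f g ⟨F, hF, hf⟩ ⟨G, hG, hg⟩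
    exact ⟨fun p => F p + G p, hF.add hG, fun p => by simp [hf, hg]⟩
  algebraMap_mem' := fun r => ⟨fun _ => r, contDiffOn_const, fun p => rfl⟩

variable {Ω : Set V}

/-- Evaluation at a point. -/
def smoothEval (p : Ω) : smoothRing Ω →ₐ[ℝ] ℝ :=
  (Pi.evalAlgHom ℝ (fun _ : Ω => ℝ) p).comp (smoothRing Ω).val

theorem smoothRing_ext {f g : smoothRing Ω} (h : ∀ p, smoothEval p f = smoothEval p g) : f = g :=
  Subtype.ext (funext h)

/-- The element of `smoothRing Ω` given by a function that is smooth on `Ω`. -/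
def smoothMk (F : V → ℝ) (hF : ContDiffOn ℝ ∞ F Ω) : smoothRing Ω :=
  ⟨fun p => F p, F, hF, fun _ => rfl⟩

theorem smoothEval_mk (F : V → ℝ) (hF : ContDiffOn ℝ ∞ F Ω) (p : Ω) :
    smoothEval p (smoothMk F hF) = F p := rfl

/-- A function on the whole space that represents `f` on `Ω`. -/
def smoothExt (f : smoothRing Ω) : V → ℝ := f.2.choose

theorem contDiffOn_smoothExt (f : smoothRing Ω) : ContDiffOn ℝ ∞ (smoothExt f) Ω :=
  f.2.choose_spec.1

theorem smoothExt_apply (f : smoothRing Ω) (p : Ω) : smoothExt f p = smoothEval p f :=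
  f.2.choose_spec.2 p

theorem differentiableWithinAt_smoothExt (f : smoothRing Ω) (p : Ω) :
    DifferentiableWithinAt ℝ (smoothExt f) Ω p :=
  (contDiffOn_smoothExt f).differentiableOn (by simp) p p.2

theorem fderivWithin_smoothExt {F : V → ℝ} (f : smoothRing Ω) (h : ∀ p : Ω, F p = smoothEval p f)
    (p : Ω) : fderivWithin ℝ (smoothExt f) Ω p = fderivWithin ℝ F Ω p :=
  fderivWithin_congr (fun x hx => by rw [smoothExt_apply f ⟨x, hx⟩, ← h])
    (by rw [smoothExt_apply f p, ← h])

/-- The directional derivative, as a derivation of `smoothRing Ω`. -/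
def smoothDeriv (hΩ : UniqueDiffOn ℝ Ω) (v : V) : Derivation ℝ (smoothRing Ω) (smoothRing Ω) :=
  Derivation.mk'
    { toFun := fun f => smoothMk (fun p => fderivWithin ℝ (smoothExt f) Ω p v)
        (((contDiffOn_smoothExt f).fderivWithin hΩ (by simp)).clm_apply contDiffOn_const)
      map_add' := fun f g => smoothRing_ext fun p => by
        rw [smoothEval_mk, fderivWithin_smoothExt (F := smoothExt f + smoothExt g) (f + g)
          (fun p => by simp [smoothExt_apply]),
          fderivWithin_add (hΩ p p.2) (differentiableWithinAt_smoothExt f p)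
            (differentiableWithinAt_smoothExt g p)]
        simp [smoothEval_mk]
      map_smul' := fun c f => smoothRing_ext fun p => by
        rw [smoothEval_mk, fderivWithin_smoothExt (F := c • smoothExt f) (c • f)
          (fun p => by simp [smoothExt_apply]),
          fderivWithin_const_smul (hΩ p p.2) (differentiableWithinAt_smoothExt f p)]
        simp [smoothEval_mk] }
    (fun f g => smoothRing_ext fun p => by
      simp only [LinearMap.coe_mk, AddHom.coe_mk, smoothEval_mk]
      rw [fderivWithin_smoothExt (F := smoothExt f * smoothExt g) (f * g)
          (fun p => by simp [smoothExt_apply]),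
        fderivWithin_mul (hΩ p p.2) (differentiableWithinAt_smoothExt f p)
          (differentiableWithinAt_smoothExt g p)]
      simp [smoothEval_mk, smoothExt_apply])

theorem smoothEval_smoothDeriv (hΩ : UniqueDiffOn ℝ Ω) (v : V) (f : smoothRing Ω) (p : Ω) :
    smoothEval p (smoothDeriv hΩ v f) = fderivWithin ℝ (smoothExt f) Ω p v := rfl

/-- Symmetry of the second derivative; at a boundary point it is inherited from nearby interior
points. -/
theorem smoothDeriv_comm (hΩ : UniqueDiffOn ℝ Ω) (hΩ' : Ω ⊆ closure (interior Ω)) (v w : V)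
    (f : smoothRing Ω) :
    smoothDeriv hΩ v (smoothDeriv hΩ w f) = smoothDeriv hΩ w (smoothDeriv hΩ v f) := by
  refine smoothRing_ext fun p => ?_
  have key : ∀ v w : V, smoothEval p (smoothDeriv hΩ v (smoothDeriv hΩ w f))
      = fderivWithin ℝ (fderivWithin ℝ (smoothExt f) Ω) Ω p v w := by
    intro v w
    rw [smoothEval_smoothDeriv, fderivWithin_smoothExt
      (F := fun q => fderivWithin ℝ (smoothExt f) Ω q w) _ fun q => rfl]
    have hd : DifferentiableWithinAt ℝ (fderivWithin ℝ (smoothExt f) Ω) Ω p :=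
      ((contDiffOn_smoothExt f).fderivWithin hΩ (m := 1) (by norm_cast)).differentiableOn
        (by simp) p p.2
    rw [fderivWithin_clm_apply (hΩ p p.2) hd (differentiableWithinAt_const w)]
    simp
  rw [key, key]
  exact (contDiffOn_smoothExt f p p.2).isSymmSndFDerivWithinAt
    (by rw [minSmoothness_of_isRCLikeNormedField]; exact WithTop.coe_le_coe.2 le_top)
    hΩ (hΩ' p.2) p.2 v w

theorem isUnit_of_smoothEval_ne_zero (f : smoothRing Ω) (h : ∀ p, smoothEval p f ≠ 0) :
    IsUnit f := by
  refine IsUnit.of_mul_eq_one (smoothMk (fun p => (smoothExt f p)⁻¹)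
    ((contDiffOn_smoothExt f).inv fun p hp => ?_)) (smoothRing_ext fun p => ?_)
  · rw [smoothExt_apply f ⟨p, hp⟩]; exact h _
  · rw [map_mul, smoothEval_mk, smoothExt_apply, map_one, mul_inv_cancel₀ (h p)]

end SmoothRing

/-! ### Families of tensor fields smooth in space and time -/

section SpaceTime

variable {n : ℕ} {T : ℝ} {U : Set (EuclideanSpace ℝ (Fin n))}

theorem uniqueDiffOn_Ico_prod (hU : IsOpen U) : UniqueDiffOn ℝ (Ico 0 T ×ˢ U) :=
  (uniqueDiffOn_Ico 0 T).prod hU.uniqueDiffOn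

theorem Ico_prod_subset_closure_interior (hU : IsOpen U) :
    Ico 0 T ×ˢ U ⊆ closure (interior (Ico 0 T ×ˢ U)) := by
  rw [interior_prod_eq, closure_prod_eq, hU.interior_eq, interior_Ico]
  rintro ⟨t, y⟩ ⟨ht, hy⟩
  refine ⟨?_, subset_closure hy⟩
  rw [closure_Ioo (ht.1.trans_lt ht.2).ne]
  exact Ico_subset_Icc_self ht

/-- The derivation `∂/∂yⁱ`. -/
def dSpace (T : ℝ) (hU : IsOpen U) (i : Fin n) :
    Derivation ℝ (smoothRing (Ico 0 T ×ˢ U)) (smoothRing (Ico 0 T ×ˢ U)) :=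
  smoothDeriv (uniqueDiffOn_Ico_prod hU) (0, coordVec i)

/-- The derivation `∂/∂t`. -/
def dTime (T : ℝ) (hU : IsOpen U) :
    Derivation ℝ (smoothRing (Ico 0 T ×ˢ U)) (smoothRing (Ico 0 T ×ˢ U)) :=
  smoothDeriv (uniqueDiffOn_Ico_prod hU) (1, 0)

theorem dSpace_comm (hU : IsOpen U) (i j : Fin n) (f : smoothRing (Ico 0 T ×ˢ U)) :
    dSpace T hU i (dSpace T hU j f) = dSpace T hU j (dSpace T hU i f) :=
  smoothDeriv_comm _ (Ico_prod_subset_closure_interior hU) _ _ f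

theorem dTime_dSpace (hU : IsOpen U) (i : Fin n) (f : smoothRing (Ico 0 T ×ˢ U)) :
    dTime T hU (dSpace T hU i f) = dSpace T hU i (dTime T hU f) :=
  smoothDeriv_comm _ (Ico_prod_subset_closure_interior hU) _ _ f

/-- The family of functions `w s`, restricted to `[0, T) × U`, is the smooth function `f`. -/
def Represents (w : ℝ → EuclideanSpace ℝ (Fin n) → ℝ) (f : smoothRing (Ico 0 T ×ˢ U)) : Prop :=
  ∀ p : ↥(Ico 0 T ×ˢ U), w p.1.1 p.1.2 = smoothEval p f

/-- Chain rule along the slice `z ↦ (s, z)`; since `U` is open, the derivative within the slice is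
the full spatial derivative even at `s = 0`. -/
theorem Represents.pderiv {w : ℝ → EuclideanSpace ℝ (Fin n) → ℝ}
    {f : smoothRing (Ico 0 T ×ˢ U)} (h : Represents w f) (hU : IsOpen U) (i : Fin n) :
    Represents (fun s => pderiv i (w s)) (dSpace T hU i f) := by
  rintro ⟨⟨s, z⟩, hs, hz⟩
  have h1 := (differentiableWithinAt_smoothExt f ⟨⟨s, z⟩, hs, hz⟩).hasFDerivWithinAt
  have h2 : HasFDerivWithinAt (fun z => (s, z)) (ContinuousLinearMap.inr ℝ ℝ _) U z :=
    (hasFDerivAt_prodMk_right s z).hasFDerivWithinAt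
  have h3 := (h1.comp z h2 fun x hx => ⟨hs, hx⟩).hasFDerivAt (hU.mem_nhds hz)
  have h4 : w s =ᶠ[𝓝 z] (smoothExt f) ∘ fun z => (s, z) := by
    filter_upwards [hU.mem_nhds hz] with x hx
    exact (h ⟨⟨s, x⟩, hs, hx⟩).trans (smoothExt_apply (Ω := Ico 0 T ×ˢ U) f ⟨(s, x), hs, hx⟩).symm
  change fderiv ℝ (w s) z _ = _
  rw [h4.fderiv_eq, h3.fderiv]
  rfl

theorem Represents.hasDerivWithinAt {w : ℝ → EuclideanSpace ℝ (Fin n) → ℝ}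
    {f : smoothRing (Ico 0 T ×ˢ U)} (h : Represents w f) (hU : IsOpen U) {t : ℝ}
    {y : EuclideanSpace ℝ (Fin n)} (ht : t ∈ Ico 0 T) (hy : y ∈ U) :
    HasDerivWithinAt (fun s => w s y) (smoothEval (Ω := Ico 0 T ×ˢ U) ⟨(t, y), ht, hy⟩ (dTime T hU f)) (Ico 0 T) t := by
  have h1 := (differentiableWithinAt_smoothExt f ⟨⟨t, y⟩, ht, hy⟩).hasFDerivWithinAt
  have h2 : HasDerivWithinAt (fun s : ℝ => (s, y)) (1, 0) (Ico 0 T) t :=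
    (hasDerivWithinAt_id t _).prodMk (hasDerivWithinAt_const t _ y)
  have hm : MapsTo (fun s : ℝ => (s, y)) (Ico 0 T) (Ico 0 T ×ˢ U) := fun x hx => ⟨hx, hy⟩
  have h3 := h1.comp_hasDerivWithinAt t h2 hm
  have h4 : ∀ s ∈ Ico 0 T, w s y = smoothExt f (s, y) := fun s hs =>
    (h ⟨⟨s, y⟩, hs, hy⟩).trans (smoothExt_apply (Ω := Ico 0 T ×ˢ U) f ⟨(s, y), hs, hy⟩).symm
  exact h3.congr h4 (h4 t ht)

end SpaceTime

/-! ### Algebraic tensors evaluate to the coordinate tensors -/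

section SpaceTimeTensors

variable {n : ℕ} {T : ℝ} {U : Set (EuclideanSpace ℝ (Fin n))}

/-- The Levi-Civita data `X` over the functions on `[0, T) × U` are those of the metrics `γ s`. -/
structure Realizes (hU : IsOpen U) (X : LeviCivita (smoothRing (Ico 0 T ×ˢ U)) n)
    (γ : ℝ → CoordTensor n 2) : Prop where
  d_eq : ∀ i, X.d i = dSpace T hU i
  metric : ∀ i j, Represents (fun s z => γ s z ![i, j]) (X.G i j)
  inverse : ∀ i j, Represents (fun s z => ginv (γ s) z i j) (X.Gi i j)
  connection : ∀ i j k, Represents (fun s z => christoffel (γ s) k i j z) (X.Γ i k j)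

theorem realizes_ofMetric (hU : IsOpen U)
    (G : Matrix (Fin n) (Fin n) (smoothRing (Ico 0 T ×ˢ U))) (hG : G.transpose = G)
    (hdet : IsUnit G.det) (γ : ℝ → CoordTensor n 2)
    (hγ : ∀ i j, Represents (fun s z => γ s z ![i, j]) (G i j)) :
    Realizes hU (LeviCivita.ofMetric (dSpace T hU) (dSpace_comm hU) G hG hdet) γ := by
  have hinv : ∀ i j, Represents (fun s z => ginv (γ s) z i j) (G⁻¹ i j) := by
    intro i j p
    have e : (Matrix.of fun i j => γ p.1.1 p.1.2 ![i, j]) = G.map (smoothEval p) := by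
      ext a b; exact hγ a b p
    have h : ginv (γ p.1.1) p.1.2 = G⁻¹.map (smoothEval p) := by
      rw [ginv, e]
      apply Matrix.inv_eq_right_inv
      rw [← Matrix.map_mul, Matrix.mul_nonsing_inv G hdet]
      exact Matrix.map_one _ (map_zero _) (map_one _)
    exact congrFun (congrFun h i) j
  refine ⟨fun _ => rfl, hγ, hinv, fun i j k p => ?_⟩
  have hp := fun i a b => (hγ a b).pderiv hU i p
  have hi := fun a b => hinv a b p
  simp only at hp hi
  simp only [christoffel, LeviCivita.ofMetric, Matrix.of_apply, map_mul, map_sum, map_add, map_sub,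
    AlgHom.commutes, hp, hi]
  rfl

namespace Realizes

variable {hU : IsOpen U} {X : LeviCivita (smoothRing (Ico 0 T ×ˢ U)) n}
  {γ : ℝ → CoordTensor n 2} (hX : Realizes hU X γ)

include hX

theorem pderiv {w : ℝ → EuclideanSpace ℝ (Fin n) → ℝ} {f : smoothRing (Ico 0 T ×ˢ U)}
    (h : Represents w f) (i : Fin n) : Represents (fun s => pderiv i (w s)) (X.d i f) := by
  rw [hX.d_eq]; exact h.pderiv hU i

theorem riemannUp (i j k l : Fin n) :
    Represents (fun s => riemannUp (γ s) k i j l) (X.Rup i j k l) := by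
  intro p
  have h1 := fun i j k => hX.connection i j k p
  have h2 := fun i j k l => hX.pderiv (hX.connection i j k) l p
  simp only at h1 h2
  simp only [GenRicciFlow.riemannUp, LeviCivita.Rup, Matrix.sub_apply, Matrix.add_apply,
    Matrix.mul_apply, derivMatrix_apply, map_sub, map_add, map_sum, map_mul, ← h1, ← h2]

theorem riemann (i j k l : Fin n) :
    Represents (fun s z => riemann (γ s) z ![i, j, k, l]) (X.Rm i j k l) := by
  intro p
  have h1 := fun i j => hX.metric i j p
  have h2 := fun i j k l => hX.riemannUp i j k l p
  simp only at h1 h2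
  simp only [LeviCivita.Rm, Matrix.mul_apply, map_sum, map_mul, ← h1, ← h2]
  rfl

theorem ricci (i k : Fin n) : Represents (fun s z => ricci (γ s) z ![i, k]) (X.Ric i k) := by
  intro p
  have h1 := fun i j => hX.inverse i j p
  have h2 := fun i j k l => hX.riemann i j k l p
  simp only at h1 h2
  simp only [LeviCivita.Ric, LeviCivita.contr, Matrix.of_apply, map_sum, map_mul, ← h1, ← h2]
  rfl

theorem covDeriv_two {w : ℝ → CoordTensor n 2}
    {S : Matrix (Fin n) (Fin n) (smoothRing (Ico 0 T ×ˢ U))}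
    (h : ∀ a b, Represents (fun s z => w s z ![a, b]) (S a b)) (i a b : Fin n) :
    Represents (fun s z => covDeriv (γ s) (w s) z ![i, a, b]) (X.covM i S a b) := by
  intro p
  have u0 : ∀ q, Function.update ![a, b] 0 q = ![q, b] := fun q => by
    ext c; fin_cases c <;> rfl
  have u1 : ∀ q, Function.update ![a, b] 1 q = ![a, q] := fun q => by
    ext c; fin_cases c <;> rfl
  have t : Fin.tail ![i, a, b] = ![a, b] := rfl
  have h1 := fun i j k => hX.connection i j k p
  have h2 := fun a b => h a b p
  have h3 := hX.pderiv (h a b) i p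
  simp only at h1 h2 h3
  simp only [covDeriv, t, Fin.sum_univ_two, u0, u1, X.covM_apply, map_sub, map_sum, map_mul, ← h1,
    ← h2, ← h3, Matrix.cons_val_zero, Matrix.cons_val_one]
  ring

theorem covDeriv_covDeriv {w : ℝ → CoordTensor n 2}
    {S : Matrix (Fin n) (Fin n) (smoothRing (Ico 0 T ×ˢ U))}
    (h : ∀ a b, Represents (fun s z => w s z ![a, b]) (S a b)) (i j a b : Fin n) :
    Represents (fun s z => covDeriv (γ s) (covDeriv (γ s) (w s)) z ![i, j, a, b])
      (X.hess i j S a b) := by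
  intro p
  have u0 : ∀ q, Function.update ![j, a, b] 0 q = ![q, a, b] := fun q => by
    ext c; fin_cases c <;> rfl
  have u1 : ∀ q, Function.update ![j, a, b] 1 q = ![j, q, b] := fun q => by
    ext c; fin_cases c <;> rfl
  have u2 : ∀ q, Function.update ![j, a, b] 2 q = ![j, a, q] := fun q => by
    ext c; fin_cases c <;> rfl
  have h1 := fun i j k => hX.connection i j k p
  have h2 := fun i a b => hX.covDeriv_two h i a b p
  have h3 := hX.pderiv (hX.covDeriv_two h j a b) i p
  simp only at h1 h2 h3
  have e : ∀ (g : CoordTensor n 2) (S : CoordTensor n 3) (z : EuclideanSpace ℝ (Fin n)),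
      covDeriv g S z ![i, j, a, b] = GenRicciFlow.pderiv i (fun z => S z ![j, a, b]) z
        - ∑ s : Fin 3, ∑ p, christoffel g p i (![j, a, b] s) z *
          S z (Function.update ![j, a, b] s p) := fun _ _ _ => rfl
  simp only [e, Fin.sum_univ_three, u0, u1, u2, LeviCivita.hess, Matrix.sub_apply, Matrix.sum_apply,
    Matrix.smul_apply, smul_eq_mul, X.covM_apply i, map_sub, map_sum, map_mul, ← h1, ← h2, ← h3,
    Matrix.cons_val_zero, Matrix.cons_val_one, show ![j, a, b] 2 = b from rfl]
  ring

theorem ricciEvolutionRHS {F : ℝ → CoordTensor n 2} {H : ℝ → CoordTensor n 3}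
    {S S' : Matrix (Fin n) (Fin n) (smoothRing (Ico 0 T ×ˢ U))}
    (hS : ∀ a b, Represents (fun s z => contractHH (γ s) (H s) z ![a, b]) (S a b))
    (hS' : ∀ a b, Represents (fun s z => contractFF (γ s) (F s) z ![a, b]) (S' a b))
    (i k : Fin n) :
    Represents (fun s z => ricciEvolutionRHS (γ s) (F s) (H s) z i k)
      (-X.linRic X.Ric i k + (1 / 4 : ℝ) • X.linRic S i k + X.linRic S' i k) := by
  intro p
  have h1 := fun i j => hX.inverse i j p
  have h2 := fun i j k l => hX.riemann i j k l p
  have h3 := fun i j => hX.ricci i j p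
  have h4 := fun i j k l => hX.covDeriv_covDeriv hS i j k l p
  have h5 := fun i j k l => hX.covDeriv_covDeriv hS' i j k l p
  have h6 := fun i j k l => hX.covDeriv_covDeriv hX.ricci i j k l p
  have h7 := fun i j => hS i j p
  have h8 := fun i j => hS' i j p
  simp only at h1 h2 h3 h4 h5 h6 h7 h8
  rw [X.neg_linRic_Ric]
  simp only [GenRicciFlow.ricciEvolutionRHS, laplacian, LeviCivita.linRic, LeviCivita.contr,
    Matrix.of_apply, map_sub, map_sum, map_mul, map_add, map_smul, map_ofNat, Matrix.cons_val_zero,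
    Matrix.cons_val_one, h1, h2, h3, h4, h5, h6, h7, h8, smul_eq_mul, mul_assoc]
  ring

end Realizes

end SpaceTimeTensors

/-! ### Nondegeneracy and smoothness of chart components -/

section Components

variable {n : ℕ} {M : Type*} [TopologicalSpace M] [ChartedSpace (EuclideanSpace ℝ (Fin n)) M]

theorem chartFrame_injective {φ : OpenPartialHomeomorph M (EuclideanSpace ℝ (Fin n))}
    (hφ : φ ∈ IsManifold.maximalAtlas (𝓡 n) ∞ M) {y : EuclideanSpace ℝ (Fin n)}
    (hy : y ∈ φ.target) : Function.Injective (chartFrame φ y) := by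
  have h1 : φ ∈ IsManifold.maximalAtlas (𝓡 n) 1 M :=
    IsManifold.maximalAtlas_subset_of_le (by simp) hφ
  have hd : φ.MDifferentiable (𝓡 n) (𝓡 n) :=
    ⟨fun x hx => (mdifferentiableAt_of_mem_maximalAtlas h1 hx).mdifferentiableWithinAt,
      fun x hx => (mdifferentiableAt_symm_of_mem_maximalAtlas h1 hx).mdifferentiableWithinAt⟩
  exact hd.symm.mfderiv_injective hy

theorem metricComp_symm [IsManifold (𝓡 n) ∞ M] (g : Metric n M)
    (φ : OpenPartialHomeomorph M (EuclideanSpace ℝ (Fin n)))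
    (y : EuclideanSpace ℝ (Fin n)) (i j : Fin n) :
    metricComp g φ y ![i, j] = metricComp g φ y ![j, i] :=
  g.symm _ _ _

/-- A kernel vector of the Gram matrix would give a tangent vector of zero length, nonzero because
the chart frame is injective. -/
theorem det_metricComp_ne_zero [IsManifold (𝓡 n) ∞ M] (g : Metric n M)
    {φ : OpenPartialHomeomorph M (EuclideanSpace ℝ (Fin n))}
    (hφ : φ ∈ IsManifold.maximalAtlas (𝓡 n) ∞ M) {y : EuclideanSpace ℝ (Fin n)}
    (hy : y ∈ φ.target) : (Matrix.of fun i j => metricComp g φ y ![i, j]).det ≠ 0 := by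
  intro h
  obtain ⟨v, hv, hv0⟩ := Matrix.exists_mulVec_eq_zero_iff.mpr h
  set w : EuclideanSpace ℝ (Fin n) := ∑ j, v j • coordVec j with hw
  have hwv : ∀ j, w j = v j := by
    intro j
    simp [hw, coordVec, Pi.single_apply]
  have h0 : ∀ i, g.inner (φ.symm y) (chartFrame φ y (coordVec i)) (chartFrame φ y w) = 0 := by
    intro i
    rw [hw, map_sum, map_sum]
    refine (Finset.sum_congr rfl fun j _ => ?_).trans (congrFun hv0 i)
    rw [map_smul, map_smul, smul_eq_mul, mul_comm]
    rfl
  have h1 : g.inner (φ.symm y) (chartFrame φ y w) (chartFrame φ y w) = 0 := by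
    conv_lhs => enter [1]; rw [hw, map_sum, map_sum]
    rw [sum_apply]
    refine Finset.sum_eq_zero fun j _ => ?_
    rw [map_smul, map_smul, smul_apply, h0, smul_zero]
  have h2 : chartFrame φ y w ≠ 0 := by
    intro h3
    rw [← map_zero (chartFrame φ y)] at h3
    refine hv (funext fun j => ?_)
    rw [← hwv, chartFrame_injective hφ hy h3]
    rfl
  exact (g.pos _ _ h2).ne' h1

/-- The spatial exterior derivative alternatizes the space-time derivative restricted to spatial
directions, and both operations are continuous linear. -/
theorem contDiffOn_dComp {r : ℕ} {T : ℝ} {η : ℝ → DiffForm n M r}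
    {φ : OpenPartialHomeomorph M (EuclideanSpace ℝ (Fin n))}
    (hη : ContDiffOn ℝ ∞ (fun p : ℝ × EuclideanSpace ℝ (Fin n) => chartForm (η p.1) φ p.2)
      (Ico 0 T ×ˢ φ.target)) (m : Fin (r + 1) → Fin n) :
    ContDiffOn ℝ ∞ (fun p : ℝ × EuclideanSpace ℝ (Fin n) => dComp (η p.1) φ p.2 m)
      (Ico 0 T ×ˢ φ.target) := by
  set Φ := fun p : ℝ × EuclideanSpace ℝ (Fin n) => chartForm (η p.1) φ p.2
  have hΩ : UniqueDiffOn ℝ (Ico 0 T ×ˢ φ.target) := uniqueDiffOn_Ico_prod φ.open_target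
  have h1 : ContDiffOn ℝ ∞ (fun p => (fderivWithin ℝ Φ (Ico 0 T ×ˢ φ.target) p).comp
      (ContinuousLinearMap.inr ℝ ℝ (EuclideanSpace ℝ (Fin n)))) (Ico 0 T ×ˢ φ.target) :=
    (hη.fderivWithin hΩ (by simp)).clm_comp contDiffOn_const
  have h2 := (ContinuousAlternatingMap.alternatizeUncurryFinCLM (n := r) ℝ
    (EuclideanSpace ℝ (Fin n)) ℝ).contDiff.comp_contDiffOn (n := ∞) h1
  have h3 := (ContinuousAlternatingMap.apply ℝ (EuclideanSpace ℝ (Fin n)) ℝ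
    (fun s => coordVec (m s))).contDiff.comp_contDiffOn (n := ∞) h2
  refine h3.congr ?_
  rintro ⟨s, z⟩ ⟨hs, hz⟩
  have h4 := (hη.differentiableOn (by simp) (s, z) ⟨hs, hz⟩).hasFDerivWithinAt
  have h5 : HasFDerivWithinAt (fun z => (s, z)) (ContinuousLinearMap.inr ℝ ℝ _) φ.target z :=
    (hasFDerivAt_prodMk_right s z).hasFDerivWithinAt
  have h6 := (h4.comp z h5 fun x hx => ⟨hs, hx⟩).hasFDerivAt (φ.open_target.mem_nhds hz)
  change ContinuousAlternatingMap.alternatizeUncurryFin (fderiv ℝ (chartForm (η s) φ) z) _ = _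
  rw [show fderiv ℝ (chartForm (η s) φ) z = _ from h6.fderiv]
  rfl

end Components

end GenRicciFlow

end

/-! ### The evolution equation -/

theorem theorem5p2 {n : ℕ} {M : Type*} [TopologicalSpace M]
    [ChartedSpace (EuclideanSpace ℝ (Fin n)) M] [IsManifold (𝓡 n) ∞ M]
    (T : ℝ) (g : ℝ → GenRicciFlow.Metric n M) (A : ℝ → GenRicciFlow.DiffForm n M 1)
    (B : ℝ → GenRicciFlow.DiffForm n M 2) (hsol : GenRicciFlow.IsSolution T g A B)
    (φ : OpenPartialHomeomorph M (EuclideanSpace ℝ (Fin n)))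
    (hφ : φ ∈ IsManifold.maximalAtlas (𝓡 n) ∞ M)
    (t : ℝ) (ht : t ∈ Set.Ico 0 T) (y : EuclideanSpace ℝ (Fin n)) (hy : y ∈ φ.target)
    (i k : Fin n) :
    HasDerivWithinAt
      (fun s => GenRicciFlow.ricci (GenRicciFlow.metricComp (g s) φ) y ![i, k])
      (GenRicciFlow.ricciEvolutionRHS (GenRicciFlow.metricComp (g t) φ)
        (GenRicciFlow.dComp (A t) φ) (GenRicciFlow.dComp (B t) φ) y i k)
      (Set.Ico 0 T) t := by
  open GenRicciFlow in
  have hU := φ.open_target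
  let G : Matrix (Fin n) (Fin n) (smoothRing (Ico 0 T ×ˢ φ.target)) :=
    Matrix.of fun a b => smoothMk _ (hsol.smooth_metric φ hφ a b)
  let F : Fin n → Fin n → smoothRing (Ico 0 T ×ˢ φ.target) :=
    fun a b => smoothMk _ (contDiffOn_dComp (hsol.smooth_A φ hφ) ![a, b])
  let H : Fin n → Fin n → Fin n → smoothRing (Ico 0 T ×ˢ φ.target) :=
    fun a b c => smoothMk _ (contDiffOn_dComp (hsol.smooth_B φ hφ) ![a, b, c])
  have hG : G.transpose = G := by
    refine Matrix.ext fun a b => smoothRing_ext fun p => ?_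
    exact metricComp_symm (g p.1.1) φ p.1.2 b a
  have hdet : IsUnit G.det := by
    refine isUnit_of_smoothEval_ne_zero _ fun p => ?_
    have h := det_metricComp_ne_zero (g p.1.1) hφ p.2.2
    rwa [AlgHom.map_det]
  have hX := realizes_ofMetric hU G hG hdet (fun s => metricComp (g s) φ) fun a b p => rfl
  set X := LeviCivita.ofMetric (dSpace T hU) (dSpace_comm hU) G hG hdet with hXdef
  let S : Matrix (Fin n) (Fin n) (smoothRing (Ico 0 T ×ˢ φ.target)) :=
    Matrix.of fun a b => ∑ p, ∑ q, ∑ r, ∑ s, X.Gi p r * X.Gi q s * H a p q * H b r s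
  let S' : Matrix (Fin n) (Fin n) (smoothRing (Ico 0 T ×ˢ φ.target)) :=
    Matrix.of fun a b => ∑ p, ∑ q, X.Gi p q * F a q * F b p
  have hS : ∀ a b, Represents (fun s z => contractHH (metricComp (g s) φ) (dComp (B s) φ) z ![a, b])
      (S a b) := by
    intro a b p
    have h1 := fun i j => hX.inverse i j p
    simp only at h1
    simp only [S, Matrix.of_apply, map_sum, map_mul, ← h1]
    rfl
  have hS' : ∀ a b, Represents
      (fun s z => contractFF (metricComp (g s) φ) (dComp (A s) φ) z ![a, b]) (S' a b) := by
    intro a b p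
    have h1 := fun i j => hX.inverse i j p
    simp only at h1
    simp only [S', Matrix.of_apply, map_sum, map_mul, ← h1]
    rfl
  have hflow : derivMatrix (dTime T hU) X.G
      = (-2 : ℝ) • X.Ric + (1 / 2 : ℝ) • S + (2 : ℝ) • S' := by
    refine Matrix.ext fun a b => smoothRing_ext fun p => ?_
    obtain ⟨⟨s, z⟩, hs, hz⟩ := p
    have h1 := (hX.metric a b).hasDerivWithinAt hU hs hz
    have h2 := hsol.metric_eq φ hφ s hs z hz a b
    -- One-sided derivatives on `[0, T)` are unique, so the flow equation becomes an identity in the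
    -- ring.
    have h3 := (uniqueDiffOn_Ico 0 T s hs).eq_deriv _ h1 h2
    refine h3.trans ?_
    have h4 := hX.ricci a b ⟨⟨s, z⟩, hs, hz⟩
    have h5 := hS a b ⟨⟨s, z⟩, hs, hz⟩
    have h6 := hS' a b ⟨⟨s, z⟩, hs, hz⟩
    simp only at h4 h5 h6
    simp only [Matrix.add_apply, Matrix.smul_apply, map_add, map_smul, ← h4, ← h5, ← h6,
      smul_eq_mul]
    ring
  have hτ : ∀ i f, dTime T hU (X.d i f) = X.d i (dTime T hU f) := dTime_dSpace hU
  have h := (hX.ricci i k).hasDerivWithinAt hU ht hy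
  rw [X.var_Ric_flow hτ S S' hflow, ← hX.ricciEvolutionRHS hS hS' i k] at h
  exact h
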